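/- Let $G$ be a connected bipartite simple graph, finite or infinite, with distance $d_G$. For vertices $x,y$ let $I_G(x,y)$ be the set of all vertices lying on shortest $(x,y)$-paths of $G$. A set $C\subseteq V(G)$ is convex if $I_G(x,y)\subseteq C$ for all $x,y\in C$; $co_G(A)$ denotes the smallest convex set containing $A\subseteq V(G)$, and $\mathcal{I}_G(A):=\bigcup_{x,y\in A}I_G(x,y)$. A copoint at a vertex $x$ is a convex set which is maximal (under inclusion) among the convex sets not containing $x$. The (geodesic) pre-hull number $ph(G)$ is the least non-negative integer $n$ such that $co_G(C\cup\{x\})=\mathcal{I}_G^{\,n}(C\cup\{x\})$ for every vertex $x$ of $G$ and every copoint $C$ at $x$, and $ph(G):=\infty$ if there is no such $n$. If $ph(G)\le 1$, then $G$ is a partial cube, that is, $G$ is isomorphic to an isometric subgraph of a hypercube: there is a set $S$ such that $G$ is isomorphic to a connected subgraph $H$ of the graph $Q_S$ with $d_H(x,y)=d_{Q_S}(x,y)$ for all vertices $x,y$ of $H$, where the vertices of $Q_S$ are the finite subsets of $S$ and two of them are adjacent if they differ in exactly one element. -/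

import Mathlib

universe u

namespace SimpleGraph

variable {V : Type u} (G : SimpleGraph V)

/-- The geodesic interval `I_G(x, y)`: all vertices lying on a shortest walk from `x` to `y`
(a shortest walk is automatically a path). -/
def geodesicInterval (x y : V) : Set V :=
  {z | ∃ p : G.Walk x y, p.length = G.dist x y ∧ z ∈ p.support}

/-- A set of vertices is (geodesically) convex if it contains the geodesic interval between any two
of its elements. -/
def IsGeodesicConvex (C : Set V) : Prop :=
  ∀ x ∈ C, ∀ y ∈ C, G.geodesicInterval x y ⊆ C

/-- The convex hull `co_G(A)`: the smallest convex set containing `A`. -/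
def geodesicHull (A : Set V) : Set V :=
  ⋂₀ {C | G.IsGeodesicConvex C ∧ A ⊆ C}

/-- The pre-hull operator: the union of all geodesic intervals between elements of `A`. -/
def preHull (A : Set V) : Set V :=
  ⋃ x ∈ A, ⋃ y ∈ A, G.geodesicInterval x y

/-- `C` is a copoint at `x`: a convex set which is maximal among those not containing `x`. -/
def IsCopointAt (C : Set V) (x : V) : Prop :=
  Maximal (fun D : Set V => G.IsGeodesicConvex D ∧ x ∉ D) C

/-- The (geodesic) pre-hull number `ph(G)`: the least `n` such that `n` iterations of the pre-hull
operator applied to `C ∪ {x}` yield the convex hull of `C ∪ {x}`, for every vertex `x` and every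
copoint `C` at `x`. It is `⊤` if there is no such `n`. -/
noncomputable def preHullNumber : ℕ∞ :=
  sInf ((fun n : ℕ => (n : ℕ∞)) '' {n : ℕ | ∀ (x : V) (C : Set V), G.IsCopointAt C x →
    G.geodesicHull (C ∪ {x}) = G.preHull^[n] (C ∪ {x})})

/-- The hypercube over an arbitrary, possibly infinite, set `S`: its vertices are the finite subsets
of `S`, two of them being adjacent if they differ in exactly one element. -/
def hypercube (S : Type u) : SimpleGraph (Finset S) where
  Adj A B := (symmDiff (A : Set S) (B : Set S)).ncard = 1
  symm := ⟨fun A B h => by rwa [symmDiff_comm]⟩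
  loopless := ⟨fun A h => by simp at h⟩

variable {G} in
/-- A subgraph `H` of `G` is isometric if it is connected and its distance function is the
restriction of that of `G`. -/
def Subgraph.IsIsometric (H : G.Subgraph) : Prop :=
  H.Connected ∧ ∀ x y : H.verts, H.coe.dist x y = G.dist (x : V) (y : V)

/-- A partial cube is (up to isomorphism) an isometric subgraph of a hypercube. -/
def IsPartialCube : Prop :=
  ∃ (S : Type u) (H : (hypercube S).Subgraph), H.IsIsometric ∧ Nonempty (G ≃g H.coe)

end SimpleGraph

/-! ### Distances in bipartite graphs, convex hulls and copoints. -/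

namespace SimpleGraph

variable {V : Type u} {G : SimpleGraph V}

/-! By Djoković's theorem it is enough that every halfspace `closerSet a b` of an edge `ab` is
convex. If some are not, choose a failure `a, b, x, y` for which the triangle `a, x, y` has least
perimeter `M`. A geodesic from `x` to `y` leaving the halfspace crosses to the side of `b` by edges
`cd` and `c'd'`, and the triangle `b, d, d'` has perimeter less than `M`.

Below `M` the graph behaves like a partial cube. So `b, d, d'` lie in a finite subset of the
`b`-side that embeds isometrically in a cube whose dimension is half their perimeter, and a largest
such set of that dimension is convex (`IsCubical.exists_extension`,
`IsCubical.exists_isGeodesicConvex`).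

Enlarge this convex set to a copoint `D` at `a`. Then `c` and `c'` lie in the hull of `D ∪ {a}` but
outside `D`, while `d ∈ D` lies on a geodesic between them. Pre-hull number at most 1 forbids this
(`IsCopointAt.notMem_of_mem_geodesicInterval`). -/

/-- The set of vertices closer to `a` than to `b`. -/
def closerSet (G : SimpleGraph V) (a b : V) : Set V :=
  {x | G.dist x a < G.dist x b}

theorem mem_closerSet {a b x : V} : x ∈ G.closerSet a b ↔ G.dist x a < G.dist x b := Iff.rfl

theorem Connected.mem_geodesicInterval (hG : G.Connected) {x y z : V} :
    z ∈ G.geodesicInterval x y ↔ G.dist x z + G.dist z y = G.dist x y := by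
  classical
  constructor
  · rintro ⟨p, hp, hz⟩
    have h1 := G.dist_le (p.takeUntil z hz)
    have h2 := G.dist_le (p.dropUntil z hz)
    have h3 := congrArg Walk.length (p.take_spec hz)
    rw [Walk.length_append] at h3
    have h4 := hG.dist_triangle (u := x) (v := z) (w := y)
    omega
  · intro h
    obtain ⟨p, hp⟩ := hG.exists_walk_length_eq_dist x z
    obtain ⟨q, hq⟩ := hG.exists_walk_length_eq_dist z y
    exact ⟨p.append q, by rw [Walk.length_append]; omega,
      by rw [Walk.mem_support_append_iff]; exact Or.inl p.end_mem_support⟩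

theorem Connected.exists_adj_dist_add_one (hG : G.Connected) {p q : V} (h : p ≠ q) :
    ∃ r, G.Adj p r ∧ G.dist r q + 1 = G.dist p q := by
  obtain ⟨w, hw⟩ := hG.exists_walk_length_eq_dist p q
  cases w with
  | nil => exact absurd rfl h
  | cons hadj w' =>
    rename_i r
    refine ⟨r, hadj, ?_⟩
    have h1 := G.dist_le w'
    have h2 := hG.dist_triangle (u := p) (v := r) (w := q)
    have h3 := dist_eq_one_iff_adj.2 hadj
    rw [Walk.length_cons] at hw
    omega

theorem Connected.dist_ne_of_adj (hG : G.Connected) (hb : G.IsBipartite) {a b : V}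
    (hab : G.Adj a b) (x : V) : G.dist x a ≠ G.dist x b := by
  intro h
  obtain ⟨c⟩ := hb
  let c' : G.Coloring Bool := G.recolorOfEquiv finTwoEquiv c
  obtain ⟨p, hp⟩ := hG.exists_walk_length_eq_dist x a
  obtain ⟨q, hq⟩ := hG.exists_walk_length_eq_dist x b
  have h1 := c'.even_length_iff_congr p
  have h2 := c'.even_length_iff_congr q
  have h3 := c'.valid hab
  rw [hp, h, ← hq, h2] at h1
  cases c' x <;> cases ha : c' a <;> cases hb : c' b <;> simp_all

/-- The two possibilities for the distances from a vertex to the ends of an edge. -/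
theorem Connected.dist_adj_cases (hG : G.Connected) (hb : G.IsBipartite) {a b : V}
    (hab : G.Adj a b) (x : V) :
    G.dist x b = G.dist x a + 1 ∨ G.dist x a = G.dist x b + 1 := by
  have h1 := hG.dist_ne_of_adj hb hab x
  have h2 := hG.dist_triangle (u := x) (v := a) (w := b)
  have h3 := hG.dist_triangle (u := x) (v := b) (w := a)
  have h4 := dist_eq_one_iff_adj.2 hab
  have h5 := dist_eq_one_iff_adj.2 hab.symm
  omega

theorem Connected.geodesicInterval_subset_closerSet (hG : G.Connected) {a b x : V}
    (hx : x ∈ G.closerSet a b) : G.geodesicInterval x a ⊆ G.closerSet a b := by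
  intro z hz
  rw [hG.mem_geodesicInterval] at hz
  rw [mem_closerSet] at hx ⊢
  have := hG.dist_triangle (u := x) (v := z) (w := b)
  omega

theorem isGeodesicConvex_geodesicHull (A : Set V) :
    G.IsGeodesicConvex (G.geodesicHull A) := by
  intro x hx y hy z hz C hC
  exact hC.1 x (hx C hC) y (hy C hC) hz

theorem subset_geodesicHull (A : Set V) : A ⊆ G.geodesicHull A :=
  fun _ hx _ hC => hC.2 hx

theorem geodesicHull_subset {A C : Set V} (hC : G.IsGeodesicConvex C) (h : A ⊆ C) :
    G.geodesicHull A ⊆ C := fun _ hx => hx C ⟨hC, h⟩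

theorem exists_isCopointAt {X : Set V} (hX : G.IsGeodesicConvex X) {a : V} (ha : a ∉ X) :
    ∃ D, X ⊆ D ∧ G.IsCopointAt D a := by
  obtain ⟨D, hD, hmax⟩ := zorn_subset_nonempty {D : Set V | G.IsGeodesicConvex D ∧ a ∉ D}
    (fun c hc hchain hne => by
      refine ⟨⋃₀ c, ⟨?_, ?_⟩, fun s hs => Set.subset_sUnion_of_mem hs⟩
      · rintro x ⟨s, hs, hxs⟩ y ⟨t, ht, hyt⟩
        rcases hchain.total hs ht with h | h
        · exact ((hc ht).1 x (h hxs) y hyt).trans (Set.subset_sUnion_of_mem ht)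
        · exact ((hc hs).1 x hxs y (h hyt)).trans (Set.subset_sUnion_of_mem hs)
      · rintro ⟨s, hs, has⟩
        exact (hc hs).2 has) X ⟨hX, ha⟩
  exact ⟨D, hD, hmax⟩

theorem geodesicHull_subset_preHull (hph : G.preHullNumber ≤ 1) {C : Set V} {x : V}
    (hC : G.IsCopointAt C x) (hG : G.Connected) :
    G.geodesicHull (C ∪ {x}) ⊆ G.preHull (C ∪ {x}) := by
  have hne : ((fun n : ℕ => (n : ℕ∞)) '' {n : ℕ | ∀ (x : V) (C : Set V), G.IsCopointAt C x →
      G.geodesicHull (C ∪ {x}) = G.preHull^[n] (C ∪ {x})}).Nonempty := by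
    by_contra h
    rw [Set.not_nonempty_iff_eq_empty] at h
    rw [preHullNumber, h, sInf_empty] at hph
    exact absurd hph (by simp)
  obtain ⟨n, hn, hn'⟩ := csInf_mem hne
  have hn1 : n ≤ 1 := by
    have : ((n : ℕ) : ℕ∞) ≤ 1 := by
      have : ((n : ℕ) : ℕ∞) = G.preHullNumber := hn'
      rw [this]; exact hph
    exact_mod_cast this
  rw [hn x C hC]
  interval_cases n
  -- The case `n = 0` is harmless because the pre-hull of a set contains the set.
  · intro z hz
    refine Set.mem_biUnion hz (Set.mem_biUnion hz ?_)
    rw [hG.mem_geodesicInterval]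
    simp
  · exact subset_rfl

/-- A copoint does not meet an interval with both ends attached to it. -/
theorem IsCopointAt.notMem_of_mem_geodesicInterval (hG : G.Connected)
    (hph : G.preHullNumber ≤ 1) {D : Set V} {a x y z : V} (hD : G.IsCopointAt D a)
    (hx : x ∈ G.geodesicHull (D ∪ {a})) (hxD : x ∉ D)
    (hy : y ∈ G.geodesicHull (D ∪ {a})) (hyD : y ∉ D)
    (hz : z ∈ G.geodesicInterval x y) : z ∉ D := by
  intro hzD
  -- By maximality, every convex set strictly above `D` contains `a`. Hence `D` is a copoint at each
  -- hull vertex outside it, in particular at `x`.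
  have hsub : ∀ D' : Set V, G.IsGeodesicConvex D' → D ⊆ D' → D' ≠ D →
      G.geodesicHull (D ∪ {a}) ⊆ D' := by
    intro D' hc hDD' hne
    apply geodesicHull_subset hc
    apply Set.union_subset hDD'
    rw [Set.singleton_subset_iff]
    by_contra ha
    exact hne (Set.Subset.antisymm (hD.2 ⟨hc, ha⟩ hDD') hDD')
  have hDx : G.IsCopointAt D x := by
    refine ⟨⟨hD.1.1, hxD⟩, fun D' hD' hle => ?_⟩
    by_contra hcon
    have hne : D' ≠ D := by
      rintro rfl
      exact hcon subset_rfl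
    exact hD'.2 (hsub D' hD'.1 hle hne hx)
  have hy' : y ∈ G.geodesicHull (D ∪ {x}) := by
    refine hsub _ (isGeodesicConvex_geodesicHull _)
      (Set.subset_union_left.trans (subset_geodesicHull _)) (fun h => hxD ?_) hy
    rw [← h]
    exact subset_geodesicHull _ (Or.inr rfl)
  have hy2 := geodesicHull_subset_preHull hph hDx hG hy'
  simp only [preHull, Set.mem_iUnion] at hy2
  obtain ⟨u, hu, v, hv, hyuv⟩ := hy2
  -- If `y` is on a geodesic from `x` to `d`, then `x, z, y, d` occur in this order on one geodesic,
  -- so `y` is between `z` and `d`, both in the convex set `D`.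
  have key : ∀ d ∈ D, y ∈ G.geodesicInterval x d → False := by
    intro d hd hyd
    apply hyD
    apply hD.1.1 z hzD d hd
    rw [hG.mem_geodesicInterval] at hyd hz ⊢
    have h1 := hG.dist_triangle (u := x) (v := z) (w := d)
    have h2 := hG.dist_triangle (u := z) (v := y) (w := d)
    omega
  rcases hu with hu | rfl <;> rcases hv with hv | hv
  · exact hyD (hD.1.1 u hu v hv hyuv)
  · rw [Set.mem_singleton_iff] at hv
    subst hv
    refine key u hu ?_
    rw [hG.mem_geodesicInterval] at hyuv ⊢
    rw [G.dist_comm (u := v) (v := y), G.dist_comm (u := y) (v := u),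
      G.dist_comm (u := v) (v := u)]
    omega
  · exact key v hv hyuv
  · rw [Set.mem_singleton_iff] at hv
    subst hv
    rw [hG.mem_geodesicInterval, dist_self, G.dist_comm (u := y)] at hyuv
    have : G.dist v y = 0 := by omega
    rw [hG.dist_eq_zero_iff] at this
    subst this
    rw [hG.mem_geodesicInterval, dist_self, G.dist_comm (u := z)] at hz
    have : G.dist v z = 0 := by omega
    rw [hG.dist_eq_zero_iff] at this
    subst this
    exact hxD hzD

end SimpleGraph

/-! ### Sets embedded isometrically in finite cubes. -/

namespace SimpleGraph

variable {V : Type u} {G : SimpleGraph V}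

/-- The sets `closerSet a b` are closed under intervals whose ends form, together with `a`, a
triangle of perimeter less than `M`. -/
def ConvexBelow (G : SimpleGraph V) (M : ℕ) : Prop :=
  ∀ a b, G.Adj a b → ∀ x ∈ G.closerSet a b, ∀ y ∈ G.closerSet a b,
    G.dist a x + G.dist a y + G.dist x y < M → G.geodesicInterval x y ⊆ G.closerSet a b

/-- `Z` induces a connected subgraph and embeds, with the distances of `G`, into the cube of
dimension `n`. -/
structure IsCubical (G : SimpleGraph V) (Z : Set V) (n : ℕ) : Prop where
  connected : ∀ S : Set V, ∀ p ∈ Z, p ∈ S → ∀ q ∈ Z, q ∉ S →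
    ∃ c ∈ Z, c ∈ S ∧ ∃ d ∈ Z, d ∉ S ∧ G.Adj c d
  embedding : ∃ φ : V → Finset ℕ, (∀ z ∈ Z, φ z ⊆ Finset.range n) ∧
    ∀ p ∈ Z, ∀ q ∈ Z, G.dist p q = (symmDiff (φ p) (φ q)).card

/-- Each coordinate separates either none or exactly two of the three pairs. -/
theorem card_symmDiff_add_card_symmDiff_le {A B C : Finset ℕ} {n : ℕ}
    (hA : A ⊆ Finset.range n) (hB : B ⊆ Finset.range n) (hC : C ⊆ Finset.range n) :
    (symmDiff A B).card + (symmDiff A C).card + (symmDiff B C).card ≤ 2 * n := by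
  have key : ∀ D : Finset ℕ, D ⊆ Finset.range n →
      D.card = ∑ i ∈ Finset.range n, if i ∈ D then 1 else 0 := by
    intro D hD
    rw [Finset.sum_ite_mem, Finset.inter_eq_right.2 hD]
    simp
  have hs : ∀ D E : Finset ℕ, D ⊆ Finset.range n → E ⊆ Finset.range n →
      symmDiff D E ⊆ Finset.range n := by
    intro D E hD hE i hi
    rw [Finset.mem_symmDiff] at hi
    rcases hi with h | h
    · exact hD h.1
    · exact hE h.1
  rw [key _ (hs _ _ hA hB), key _ (hs _ _ hA hC), key _ (hs _ _ hB hC), ← Finset.sum_add_distrib,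
    ← Finset.sum_add_distrib]
  calc _ ≤ ∑ i ∈ Finset.range n, 2 := by
        apply Finset.sum_le_sum
        intro i _
        simp only [Finset.mem_symmDiff]
        by_cases h1 : i ∈ A <;> by_cases h2 : i ∈ B <;> by_cases h3 : i ∈ C <;> simp [h1, h2, h3]
    _ = 2 * n := by simp [mul_comm]

theorem card_symmDiff_singleton_symmDiff (A B : Finset ℕ) (i : ℕ) :
    (i ∈ symmDiff A B → (symmDiff (symmDiff A {i}) B).card + 1 = (symmDiff A B).card) ∧
    (i ∉ symmDiff A B → (symmDiff (symmDiff A {i}) B).card = (symmDiff A B).card + 1) := by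
  have h : symmDiff (symmDiff A {i}) B = symmDiff (symmDiff A B) {i} := by
    rw [symmDiff_right_comm]
  rw [h]
  constructor
  · intro hi
    have : symmDiff (symmDiff A B) {i} = (symmDiff A B).erase i := by
      ext j
      simp only [Finset.mem_symmDiff, Finset.mem_erase, Finset.mem_singleton] at hi ⊢
      by_cases hj : j = i
      · subst hj; tauto
      · tauto
    rw [this, Finset.card_erase_add_one hi]
  · intro hi
    have : symmDiff (symmDiff A B) {i} = insert i (symmDiff A B) := by
      ext j
      simp only [Finset.mem_symmDiff, Finset.mem_insert, Finset.mem_singleton] at hi ⊢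
      by_cases hj : j = i
      · subst hj; tauto
      · tauto
    rw [this, Finset.card_insert_of_notMem hi]

theorem IsCubical.perimeter_le {Z : Set V} {n : ℕ} (hZ : G.IsCubical Z n) {p q r : V}
    (hp : p ∈ Z) (hq : q ∈ Z) (hr : r ∈ Z) :
    G.dist p q + G.dist p r + G.dist q r ≤ 2 * n := by
  obtain ⟨φ, hφ, hd⟩ := hZ.embedding
  rw [hd p hp q hq, hd p hp r hr, hd q hq r hr]
  exact card_symmDiff_add_card_symmDiff_le (hφ p hp) (hφ q hq) (hφ r hr)

theorem isCubical_singleton (v : V) : G.IsCubical {v} 0 where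
  connected := by
    rintro S p rfl hp q rfl hq
    exact absurd hp hq
  embedding := ⟨fun _ => ∅, by simp, by simp⟩

theorem IsCubical.connected_insert {Z : Set V} {n : ℕ} (hZ : G.IsCubical Z n) {p r : V}
    (hp : p ∈ Z) (hpr : G.Adj p r) (S : Set V) : ∀ p ∈ insert r Z, p ∈ S → ∀ q ∈ insert r Z,
    q ∉ S → ∃ c ∈ insert r Z, c ∈ S ∧ ∃ d ∈ insert r Z, d ∉ S ∧ G.Adj c d := by
  have aux : ∀ u ∈ Z, u ∈ S → ∀ v ∈ Z, v ∉ S →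
      ∃ c ∈ insert r Z, c ∈ S ∧ ∃ d ∈ insert r Z, d ∉ S ∧ G.Adj c d := by
    intro u hu huS v hv hvS
    obtain ⟨c, hc, hcS, d, hd, hdS, hcd⟩ := hZ.connected S u hu huS v hv hvS
    exact ⟨c, Or.inr hc, hcS, d, Or.inr hd, hdS, hcd⟩
  rintro u (rfl | hu) huS v (rfl | hv) hvS
  · exact absurd huS hvS
  · by_cases hpS : p ∈ S
    · exact aux p hp hpS v hv hvS
    · exact ⟨u, Or.inl rfl, huS, p, Or.inr hp, hpS, hpr.symm⟩
  · by_cases hpS : p ∈ S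
    · exact ⟨p, Or.inr hp, hpS, v, Or.inl rfl, hvS, hpr⟩
    · exact aux u hu huS p hp hpS
  · exact aux u hu huS v hv hvS

theorem IsCubical.insert_of_embedding {Z : Set V} {n m : ℕ} (hZ : G.IsCubical Z n) {p r : V}
    (hp : p ∈ Z) (hpr : G.Adj p r) (hr : r ∉ Z) {φ : V → Finset ℕ} {A : Finset ℕ}
    (hφ : ∀ z ∈ Z, φ z ⊆ Finset.range m)
    (hd : ∀ p ∈ Z, ∀ q ∈ Z, G.dist p q = (symmDiff (φ p) (φ q)).card)
    (hA : A ⊆ Finset.range m) (hdA : ∀ z ∈ Z, G.dist r z = (symmDiff A (φ z)).card) :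
    G.IsCubical (insert r Z) m where
  connected := hZ.connected_insert hp hpr
  embedding := by
    classical
    have hne : ∀ z ∈ Z, Function.update φ r A z = φ z := by
      intro z hz
      rw [Function.update_of_ne]
      rintro rfl
      exact hr hz
    refine ⟨Function.update φ r A, ?_, ?_⟩
    · rintro z (rfl | hz)
      · simpa using hA
      · rw [hne z hz]; exact hφ z hz
    · rintro u (rfl | hu) v (rfl | hv)
      · simp
      · rw [hne v hv, Function.update_self]; exact hdA v hv
      · rw [hne u hu, Function.update_self, G.dist_comm, symmDiff_comm]; exact hdA u hu
      · rw [hne u hu, hne v hv]; exact hd u hu v hv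

variable (hG : G.Connected) (hb : G.IsBipartite)
include hG hb

/-- The edge `pr` cuts `Z` nontrivially, and it does so exactly as some edge `cd` of `Z` does. The
coordinate of `cd` can therefore be reused for `r`, without raising the dimension. -/
theorem IsCubical.insert_of_mem_closerSet {M : ℕ} (hM : G.ConvexBelow M) {Z : Set V} {n : ℕ}
    (hZ : G.IsCubical Z n) (hn : 2 * n < M) {p q r : V} (hp : p ∈ Z) (hq : q ∈ Z)
    (hpr : G.Adj p r) (hqr : q ∈ G.closerSet r p) : G.IsCubical (insert r Z) n := by
  by_cases hr : r ∈ Z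
  · rwa [Set.insert_eq_of_mem hr]
  obtain ⟨φ, hφ, hd⟩ := hZ.embedding
  have hpp : p ∈ G.closerSet p r := by
    rw [mem_closerSet, dist_self, dist_eq_one_iff_adj.2 hpr]; exact Nat.one_pos
  rw [mem_closerSet] at hqr
  obtain ⟨c, hc, hcS, d, hd', hdS, hcd⟩ := hZ.connected (G.closerSet p r) p hp hpp q hq
    (by rw [mem_closerSet]; omega)
  rw [mem_closerSet] at hcS hdS
  have hcases := fun z => hG.dist_adj_cases hb hpr z
  have hcases' := fun z => hG.dist_adj_cases hb hcd z
  have hcd1 := dist_eq_one_iff_adj.2 hcd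
  -- Otherwise `c` is between `d` and `z`, both on the side of `r`. The triangle `r, d, z` is small
  -- enough for `ConvexBelow` to put `c` on that side too, a contradiction.
  have h1 : ∀ z ∈ Z, G.dist z r < G.dist z p → G.dist z d < G.dist z c := by
    intro z hz hzr
    by_contra hcon
    have hp3 := hZ.perimeter_le hp hd' hz
    have e1 := hcases d
    have e2 := hcases z
    have e3 := hcases' z
    have hmem := hM r p hpr.symm d (by rw [mem_closerSet]; omega) z (by rw [mem_closerSet]; omega)
      (by rw [G.dist_comm (u := r) (v := d), G.dist_comm (u := r) (v := z)]
          rw [G.dist_comm (u := p) (v := d), G.dist_comm (u := p) (v := z)] at hp3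
          omega)
      (show c ∈ _ by
        rw [hG.mem_geodesicInterval, G.dist_comm (u := d) (v := c), G.dist_comm (u := c) (v := z),
          G.dist_comm (u := d) (v := z)]
        omega)
    rw [mem_closerSet] at hmem
    omega
  have h2 : ∀ z ∈ Z, G.dist z p < G.dist z r → G.dist z c < G.dist z d := by
    intro z hz hzr
    by_contra hcon
    have hp3 := hZ.perimeter_le hp hc hz
    have e3 := hcases' z
    have hmem := hM p r hpr c (by rw [mem_closerSet]; omega) z (by rw [mem_closerSet]; omega)
      (by omega)
      (show d ∈ _ by
        rw [hG.mem_geodesicInterval, G.dist_comm (u := d) (v := z),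
          G.dist_comm (u := c) (v := z)]
        omega)
    rw [mem_closerSet] at hmem
    omega
  have hcdφ := hd c hc d hd'
  rw [hcd1] at hcdφ
  obtain ⟨i, hi⟩ := Finset.card_eq_one.1 hcdφ.symm
  have hdφ : φ d = symmDiff (φ c) {i} := by
    rw [← hi, symmDiff_symmDiff_cancel_left]
  have hside : ∀ z ∈ Z, (G.dist z c < G.dist z d ↔ i ∉ symmDiff (φ c) (φ z)) := by
    intro z hz
    have hk := card_symmDiff_singleton_symmDiff (φ c) (φ z) i
    rw [← hdφ, ← hd c hc z hz, ← hd d hd' z hz, G.dist_comm (u := c), G.dist_comm (u := d)] at hk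
    constructor
    · intro h hmem
      have := hk.1 hmem
      omega
    · intro h
      have := hk.2 h
      omega
  have hpc : i ∉ symmDiff (φ c) (φ p) := (hside p hp).1 (h2 p hp (by
    rw [dist_self, dist_eq_one_iff_adj.2 hpr]; exact Nat.one_pos))
  have hir : i ∈ Finset.range n := by
    have : i ∈ symmDiff (φ c) (φ d) := by rw [hi]; exact Finset.mem_singleton_self i
    rw [Finset.mem_symmDiff] at this
    rcases this with h | h
    · exact hφ c hc h.1
    · exact hφ d hd' h.1
  refine hZ.insert_of_embedding hp hpr hr (A := symmDiff (φ p) {i}) hφ hd ?_ ?_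
  · intro j hj
    rw [Finset.mem_symmDiff, Finset.mem_singleton] at hj
    rcases hj with h | h
    · exact hφ p hp h.1
    · rw [h.1]; exact hir
  · intro z hz
    have hk := card_symmDiff_singleton_symmDiff (φ p) (φ z) i
    rw [← hd p hp z hz] at hk
    have hpz : i ∈ symmDiff (φ p) (φ z) ↔ i ∈ symmDiff (φ c) (φ z) := by
      simp only [Finset.mem_symmDiff] at hpc ⊢
      tauto
    have e := hcases z
    have hs := hside z hz
    rw [G.dist_comm (u := r) (v := z)]
    rw [G.dist_comm (u := p) (v := z)] at hk
    rcases e with e | e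
    · have := h2 z hz (by omega)
      rw [hk.2 (by rw [hpz]; exact hs.1 this)]
      exact e
    · have := h1 z hz (by omega)
      have := hk.1 (by rw [hpz]; by_contra h; have := hs.2 h; omega)
      omega

/-- Every vertex of `Z` is one step further from `r` than from `p`, so `r` gets the image of `p`
together with the fresh coordinate `n`. -/
theorem IsCubical.insert_of_subset_closerSet {Z : Set V} {n : ℕ}
    (hZ : G.IsCubical Z n) {p r : V} (hp : p ∈ Z)
    (hpr : G.Adj p r) (hr : Z ⊆ G.closerSet p r) : G.IsCubical (insert r Z) (n + 1) := by
  obtain ⟨φ, hφ, hd⟩ := hZ.embedding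
  have hrZ : r ∉ Z := by
    intro h
    have := hr h
    rw [mem_closerSet, dist_self] at this
    omega
  refine hZ.insert_of_embedding hp hpr hrZ (φ := φ) (A := symmDiff (φ p) {n}) ?_ hd ?_ ?_
  · exact fun z hz => (hφ z hz).trans (Finset.range_mono (Nat.le_succ n))
  · intro j hj
    rw [Finset.mem_symmDiff, Finset.mem_singleton] at hj
    rcases hj with h | h
    · exact Finset.range_mono (Nat.le_succ n) (hφ p hp h.1)
    · rw [h.1]; simp
  · intro z hz
    have hk := (card_symmDiff_singleton_symmDiff (φ p) (φ z) n).2 (by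
      rw [Finset.mem_symmDiff]
      rintro (h | h)
      · exact absurd (hφ p hp h.1) (by simp)
      · exact absurd (hφ z hz h.1) (by simp))
    rw [hk, ← hd p hp z hz]
    have := hr hz
    rw [mem_closerSet] at this
    have e := hG.dist_adj_cases hb hpr z
    rw [G.dist_comm (u := r), G.dist_comm (u := p)]
    omega

/-- Following a geodesic from `v` to `w` inside `S`, a cubical set containing `u` and `v` of
dimension half the perimeter can be extended to reach `w`. -/
theorem IsCubical.exists_extension {M : ℕ} (hM : G.ConvexBelow M) {S : Set V} {u v w : V}
    (hS : G.geodesicInterval v w ⊆ S) (hw : G.dist u v + G.dist v w + G.dist u w < M) :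
    ∀ (k : ℕ) (p : V) (Z : Set V) (n : ℕ), p ∈ G.geodesicInterval v w → G.dist p w = k →
      G.IsCubical Z n → u ∈ Z → v ∈ Z → p ∈ Z → Z ⊆ S →
      2 * n = G.dist u v + G.dist v p + G.dist u p →
      ∃ (Z' : Set V) (m : ℕ), G.IsCubical Z' m ∧ u ∈ Z' ∧ v ∈ Z' ∧ w ∈ Z' ∧ Z' ⊆ S ∧
        2 * m = G.dist u v + G.dist v w + G.dist u w := by
  intro k
  induction k with
  | zero =>
    intro p Z n hp hk hZ hu hv hpZ hZS hn
    rw [hG.dist_eq_zero_iff] at hk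
    subst hk
    exact ⟨Z, n, hZ, hu, hv, hpZ, hZS, hn⟩
  | succ k ih =>
    intro p Z n hp hk hZ hu hv hpZ hZS hn
    obtain ⟨r, hpr, hrw⟩ := hG.exists_adj_dist_add_one (p := p) (q := w)
      (by rintro rfl; rw [dist_self] at hk; omega)
    rw [hG.mem_geodesicInterval] at hp
    have hpr1 := dist_eq_one_iff_adj.2 hpr
    have t1 := hG.dist_triangle (u := v) (v := r) (w := w)
    have t2 := hG.dist_triangle (u := v) (v := p) (w := r)
    have t3 := hG.dist_triangle (u := u) (v := w) (w := p)
    rw [G.dist_comm (u := w) (v := p)] at t3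
    have hrI : r ∈ G.geodesicInterval v w := by rw [hG.mem_geodesicInterval]; omega
    have hvr : G.dist v r = G.dist v p + 1 := by omega
    have hnM : 2 * n < M := by omega
    have hsub : insert r Z ⊆ S := Set.insert_subset (hS hrI) hZS
    rcases hG.dist_adj_cases hb hpr u with e | e
    · have hZr : Z ⊆ G.closerSet p r := by
        -- The perimeter has grown by 2. Were some `q` closer to `r`, then `r` could be added in
        -- dimension `n`, violating the perimeter bound `2 * n`.
        intro q hq
        by_contra hqr
        have h := hZ.insert_of_mem_closerSet hG hb hM hnM hpZ hq hpr (by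
          have := hG.dist_adj_cases hb hpr q
          rw [mem_closerSet] at hqr ⊢
          omega)
        have := h.perimeter_le (p := v) (q := u) (r := r) (Or.inr hv) (Or.inr hu) (Or.inl rfl)
        rw [G.dist_comm (u := v) (v := u)] at this
        omega
      exact ih r (insert r Z) (n + 1) hrI (by omega)
        (hZ.insert_of_subset_closerSet hG hb hpZ hpr hZr) (Or.inr hu) (Or.inr hv) (Or.inl rfl)
        hsub (by omega)
    · exact ih r (insert r Z) n hrI (by omega)
        (hZ.insert_of_mem_closerSet hG hb hM hnM hpZ hu hpr (by rw [mem_closerSet]; omega))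
        (Or.inr hu) (Or.inr hv) (Or.inl rfl) hsub (by omega)

omit hb in
theorem IsCubical.ncard_le {Z : Set V} {n : ℕ} (hZ : G.IsCubical Z n) : Z.ncard ≤ 2 ^ n := by
  obtain ⟨φ, hφ, hd⟩ := hZ.embedding
  have hinj : Set.InjOn φ Z := by
    intro p hp q hq h
    have := hd p hp q hq
    rw [h, symmDiff_self] at this
    exact hG.dist_eq_zero_iff.1 (by simpa using this)
  rw [← hinj.ncard_image]
  calc _ ≤ ((Finset.range n).powerset : Set (Finset ℕ)).ncard := by
        apply Set.ncard_le_ncard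
        · rintro _ ⟨z, hz, rfl⟩
          exact Finset.mem_coe.2 (Finset.mem_powerset.2 (hφ z hz))
        · exact Finset.finite_toSet _
    _ = 2 ^ n := by rw [Set.ncard_coe_finset, Finset.card_powerset, Finset.card_range]

omit hb in
theorem IsCubical.finite {Z : Set V} {n : ℕ} (hZ : G.IsCubical Z n) : Z.Finite := by
  obtain ⟨φ, hφ, hd⟩ := hZ.embedding
  have hinj : Set.InjOn φ Z := by
    intro p hp q hq h
    have := hd p hp q hq
    rw [h, symmDiff_self] at this
    exact hG.dist_eq_zero_iff.1 (by simpa using this)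
  refine Set.Finite.of_finite_image ((Finset.finite_toSet (Finset.range n).powerset).subset ?_) hinj
  rintro _ ⟨z, hz, rfl⟩
  exact Finset.mem_coe.2 (Finset.mem_powerset.2 (hφ z hz))

/-- A cubical set of small dimension inside `closerSet b a` is contained in a convex set inside
`closerSet b a`. -/
theorem IsCubical.exists_isGeodesicConvex {M : ℕ} (hM : G.ConvexBelow M) {a b : V}
    (hab : G.Adj b a) {Z : Set V} {n : ℕ} (hZ : G.IsCubical Z n) (hn : 2 * n < M)
    (hbZ : b ∈ Z) (hZS : Z ⊆ G.closerSet b a) :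
    ∃ X, G.IsGeodesicConvex X ∧ Z ⊆ X ∧ X ⊆ G.closerSet b a := by
  let K : Set ℕ := {k | ∃ X, G.IsCubical X n ∧ Z ⊆ X ∧ X ⊆ G.closerSet b a ∧ X.ncard = k}
  have hKne : K.Nonempty := ⟨_, Z, hZ, subset_rfl, hZS, rfl⟩
  have hKb : BddAbove K := ⟨2 ^ n, by rintro _ ⟨X, hX, -, -, rfl⟩; exact hX.ncard_le hG⟩
  obtain ⟨X, hX, hZX, hXS, hcard⟩ := Nat.sSup_mem hKne hKb
  refine ⟨X, ?_, hZX, hXS⟩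
  -- A missing `r` could be added in the same dimension. It stays on the side of `b` since the
  -- triangle `b, p, q` has perimeter at most `2 * n`, so `X` would not be largest.
  have step : ∀ p ∈ X, ∀ q ∈ X, ∀ r, G.Adj p r → G.dist r q + 1 = G.dist p q → r ∈ X := by
    intro p hp q hq r hpr hrq
    by_contra hr
    have hcub := hX.insert_of_mem_closerSet hG hb hM hn hp hq hpr (by
      rw [mem_closerSet, G.dist_comm (u := q), G.dist_comm (u := q)]; omega)
    have hper := hX.perimeter_le (hZX hbZ) hp hq
    have hrS : r ∈ G.closerSet b a := by
      refine hM b a hab p (hXS hp) q (hXS hq) (by omega) ?_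
      rw [hG.mem_geodesicInterval, dist_eq_one_iff_adj.2 hpr]
      omega
    have hmem : X.ncard + 1 ∈ K := ⟨insert r X, hcub, hZX.trans (Set.subset_insert _ _),
      Set.insert_subset hrS hXS, Set.ncard_insert_of_notMem hr (hX.finite hG)⟩
    have := le_csSup hKb hmem
    omega
  have main : ∀ (k : ℕ) (p : V), p ∈ X → ∀ q ∈ X, ∀ z ∈ G.geodesicInterval p q,
      G.dist p z = k → z ∈ X := by
    intro k
    induction k with
    | zero =>
      intro p hp q _ z _ hk
      rw [hG.dist_eq_zero_iff] at hk
      rwa [← hk]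
    | succ k ih =>
      intro p hp q hq z hz hk
      obtain ⟨r, hpr, hrz⟩ := hG.exists_adj_dist_add_one (p := p) (q := z)
        (by rintro rfl; rw [dist_self] at hk; omega)
      rw [hG.mem_geodesicInterval] at hz
      have t1 := hG.dist_triangle (u := r) (v := z) (w := q)
      have t2 := hG.dist_triangle (u := p) (v := r) (w := q)
      have t3 := dist_eq_one_iff_adj.2 hpr
      exact ih r (step p hp q hq r hpr (by omega)) q hq z
        (by rw [hG.mem_geodesicInterval]; omega) (by omega)
  exact fun p hp q hq z hz => main _ p hp q hq z hz rfl

end SimpleGraph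

/-! ### Convexity of halfspaces. -/

namespace SimpleGraph

variable {V : Type u} {G : SimpleGraph V}

theorem Connected.exists_adj_crossing (hG : G.Connected) {S : Set V} {z : V} (hz : z ∉ S) :
    ∀ (k : ℕ) (x : V), x ∈ S → G.dist x z = k →
      ∃ c ∈ S, ∃ d ∉ S, G.Adj c d ∧ G.dist x c + 1 + G.dist d z = G.dist x z := by
  intro k
  induction k with
  | zero =>
    intro x hx hk
    rw [hG.dist_eq_zero_iff] at hk
    subst hk
    exact absurd hx hz
  | succ k ih =>
    intro x hx hk
    obtain ⟨r, hxr, hrz⟩ := hG.exists_adj_dist_add_one (p := x) (q := z)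
      (by rintro rfl; exact hz hx)
    by_cases hr : r ∈ S
    · obtain ⟨c, hc, d, hd, hcd, h⟩ := ih r hr (by omega)
      refine ⟨c, hc, d, hd, hcd, ?_⟩
      have t1 := hG.dist_triangle (u := x) (v := r) (w := c)
      have t2 := hG.dist_triangle (u := x) (v := c) (w := z)
      have t3 := hG.dist_triangle (u := c) (v := d) (w := z)
      rw [dist_eq_one_iff_adj.2 hxr] at t1
      rw [dist_eq_one_iff_adj.2 hcd] at t3
      omega
    · exact ⟨x, hx, r, hr, hxr, by rw [dist_self]; omega⟩

variable (hG : G.Connected) (hb : G.IsBipartite)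
include hG hb

theorem Connected.notMem_closerSet {a b : V} (hab : G.Adj a b) {x : V} :
    x ∉ G.closerSet a b ↔ x ∈ G.closerSet b a := by
  have := hG.dist_ne_of_adj hb hab x
  rw [mem_closerSet, mem_closerSet]
  omega

theorem exists_isGeodesicConvex_of_convexBelow {M : ℕ} (hM : G.ConvexBelow M) {a b d d' : V}
    (hab : G.Adj a b) (hd : d ∈ G.closerSet b a) (hd' : d' ∈ G.closerSet b a)
    (h : G.dist b d + G.dist b d' + G.dist d d' < M) :
    ∃ X, G.IsGeodesicConvex X ∧ b ∈ X ∧ d ∈ X ∧ d' ∈ X ∧ a ∉ X := by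
  have t := hG.dist_triangle (u := b) (v := d') (w := d)
  rw [G.dist_comm (u := d') (v := d)] at t
  -- The degenerate triangle `d, d, b` yields a cubical set of dimension `d(b, d)` containing `b`
  -- and `d`, the starting point for reaching `d'`.
  obtain ⟨Z₁, m, hZ₁, hd₁, -, hb₁, hS₁, hm⟩ :=
    IsCubical.exists_extension hG hb hM (u := d) (v := d) (w := b)
      (hG.geodesicInterval_subset_closerSet hd)
      (by rw [dist_self, G.dist_comm (u := d) (v := b)]; omega) _ d {d} 0
      (by rw [hG.mem_geodesicInterval, dist_self, Nat.zero_add]) rfl (isCubical_singleton d)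
      rfl rfl rfl (Set.singleton_subset_iff.2 hd) (by rw [dist_self])
  rw [dist_self, G.dist_comm (u := d) (v := b)] at hm
  obtain ⟨Z₂, n, hZ₂, hb₂, hd₂, hd₂', hS₂, hn⟩ :=
    IsCubical.exists_extension hG hb hM (u := b) (v := d) (w := d')
      (hM b a hab.symm d hd d' hd' h) (by omega) _ d Z₁ m
      (by rw [hG.mem_geodesicInterval, dist_self, Nat.zero_add]) rfl hZ₁ hb₁ hd₁ hd₁ hS₁
      (by rw [dist_self]; omega)
  obtain ⟨X, hX, hZX, hXS⟩ := hZ₂.exists_isGeodesicConvex hG hb hM hab.symm (by omega) hb₂ hS₂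
  refine ⟨X, hX, hZX hb₂, hZX hd₂, hZX hd₂', fun ha => ?_⟩
  have := hXS ha
  rw [mem_closerSet, dist_self] at this
  omega

theorem isGeodesicConvex_closerSet (hph : G.preHullNumber ≤ 1) {a b : V} (hab : G.Adj a b) :
    G.IsGeodesicConvex (G.closerSet a b) := by
  classical
  by_contra hcon
  have hex : ∃ M, ∃ a b, G.Adj a b ∧ ∃ x ∈ G.closerSet a b, ∃ y ∈ G.closerSet a b,
      G.dist a x + G.dist a y + G.dist x y = M ∧
        ¬ G.geodesicInterval x y ⊆ G.closerSet a b := by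
    simp only [IsGeodesicConvex, not_forall] at hcon
    obtain ⟨x, hx, y, hy, h⟩ := hcon
    exact ⟨_, a, b, hab, x, hx, y, hy, rfl, h⟩
  obtain ⟨a, b, hab, x, hx, y, hy, hM, hxy⟩ := Nat.find_spec hex
  have hbelow : G.ConvexBelow (Nat.find hex) := by
    intro a b hab x hx y hy hlt
    by_contra h
    exact Nat.find_min hex hlt ⟨a, b, hab, x, hx, y, hy, rfl, h⟩
  rw [Set.not_subset] at hxy
  obtain ⟨z, hz, hzS⟩ := hxy
  rw [hG.mem_geodesicInterval] at hz
  obtain ⟨c, hc, d, hd, hcd, hxc⟩ := hG.exists_adj_crossing hzS _ x hx rfl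
  obtain ⟨c', hc', d', hd', hcd', hyc⟩ := hG.exists_adj_crossing hzS _ y hy rfl
  rw [hG.notMem_closerSet hb hab] at hd hd'
  have e1 : G.dist c d = 1 := dist_eq_one_iff_adj.2 hcd
  have e2 : G.dist c' d' = 1 := dist_eq_one_iff_adj.2 hcd'
  have hside : ∀ {p q}, G.Adj p q → p ∈ G.closerSet a b → q ∈ G.closerSet b a →
      G.dist b q = G.dist a p ∧ G.dist q a = G.dist p a + 1 ∧ G.dist p b = G.dist p a + 1 := by
    intro p q hpq hp hq
    rw [mem_closerSet] at hp hq
    have h1 := hG.dist_adj_cases hb hab p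
    have h2 := hG.dist_adj_cases hb hab q
    have h3 := hG.dist_adj_cases hb hpq a
    have h4 := hG.dist_adj_cases hb hpq b
    rw [G.dist_comm (u := b) (v := q), G.dist_comm (u := a) (v := p)]
    rw [G.dist_comm (u := a) (v := q), G.dist_comm (u := a) (v := p)] at h3
    rw [G.dist_comm (u := b) (v := q), G.dist_comm (u := b) (v := p)] at h4
    omega
  obtain ⟨s1, s2, s3⟩ := hside hcd hc hd
  obtain ⟨s1', s2', s3'⟩ := hside hcd' hc' hd'
  have t1 := hG.dist_triangle (u := x) (v := c) (w := y)
  have t2 := hG.dist_triangle (u := c) (v := c') (w := y)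
  have t3 := hG.dist_triangle (u := c) (v := d) (w := c')
  have t4 := hG.dist_triangle (u := d) (v := d') (w := c')
  have t5 := hG.dist_triangle (u := d) (v := z) (w := d')
  have t6 := hG.dist_triangle (u := a) (v := x) (w := c)
  have t7 := hG.dist_triangle (u := a) (v := y) (w := c')
  rw [G.dist_comm (u := d') (v := c')] at t4
  rw [G.dist_comm (u := z) (v := d')] at t5
  rw [G.dist_comm (u := c') (v := y)] at t2
  rw [G.dist_comm (u := z) (v := y)] at hz
  -- The perimeter of `b, d, d'` is at most that of `a, x, y` minus 2, one for each crossing edge.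
  obtain ⟨X, hX, hbX, hdX, hdX', haX⟩ :=
    exists_isGeodesicConvex_of_convexBelow hG hb hbelow hab hd hd' (by omega)
  obtain ⟨D, hXD, hD⟩ := exists_isCopointAt hX haX
  -- For such `p`, `a` lies between `p` and `b ∈ D`.
  have hnot : ∀ {p}, G.dist p b = G.dist p a + 1 → p ∉ D := by
    intro p hp hpD
    refine hD.1.2 (hD.1.1 p hpD b (hXD hbX) ?_)
    rw [hG.mem_geodesicInterval, dist_eq_one_iff_adj.2 hab]
    omega
  have hmem : ∀ {p q}, q ∈ X → G.dist q p = 1 → G.dist q a = G.dist p a + 1 →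
      p ∈ G.geodesicHull (D ∪ {a}) := by
    intro p q hq hqp h
    refine isGeodesicConvex_geodesicHull _ q (subset_geodesicHull _ (Or.inl (hXD hq))) a
      (subset_geodesicHull _ (Or.inr rfl)) ?_
    rw [hG.mem_geodesicInterval]
    omega
  refine hD.notMem_of_mem_geodesicInterval hG hph
    (hmem hdX (by rw [G.dist_comm]; exact e1) s2) (hnot s3)
    (hmem hdX' (by rw [G.dist_comm]; exact e2) s2') (hnot s3') (z := d) ?_ (hXD hdX)
  rw [hG.mem_geodesicInterval]
  omega

end SimpleGraph

/-! ### Djoković's theorem: embedding by halfspaces. -/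

namespace SimpleGraph

variable {V : Type u} {G : SimpleGraph V}

/-- The sets `closerSet a b`, over all edges `ab`, that contain `v` and not the base vertex. -/
def separatingSets (G : SimpleGraph V) (v₀ v : V) : Set (Set V) :=
  {H | (∃ a b, G.Adj a b ∧ H = G.closerSet a b) ∧ v ∈ H ∧ v₀ ∉ H}

theorem dist_iso {W : Type*} {G' : SimpleGraph W} (e : G ≃g G') (hG : G.Connected) (u v : V) :
    G'.dist (e u) (e v) = G.dist u v := by
  apply le_antisymm
  · obtain ⟨p, hp⟩ := hG.exists_walk_length_eq_dist u v
    rw [← hp, ← Walk.length_map e.toHom p]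
    exact dist_le _
  · obtain ⟨p, hp⟩ := ((e.connected_iff).1 hG).exists_walk_length_eq_dist (e u) (e v)
    rw [← hp, ← Walk.length_map e.symm.toHom p]
    have h := G.dist_le (p.map e.symm.toHom)
    simpa using h

theorem hypercube_ncard_symmDiff_le {S : Type u} {A B : Finset S} (p : (hypercube S).Walk A B) :
    (symmDiff (A : Set S) (B : Set S)).ncard ≤ p.length := by
  classical
  induction p with
  | nil => simp
  | cons h p ih =>
    rename_i A C B
    have h1 : (symmDiff (A : Set S) (C : Set S)).ncard = 1 := h
    have h2 : (symmDiff (A : Set S) (B : Set S)) ⊆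
        symmDiff (A : Set S) (C : Set S) ∪ symmDiff (C : Set S) (B : Set S) :=
      symmDiff_triangle _ _ _
    have hfin : ∀ D E : Finset S, (symmDiff (D : Set S) (E : Set S)).Finite := by
      intro D E
      rw [← Finset.coe_symmDiff]
      exact Finset.finite_toSet _
    have h3 := Set.ncard_le_ncard h2 ((hfin _ _).union (hfin _ _))
    have h4 := Set.ncard_union_le (symmDiff (A : Set S) (C : Set S))
      (symmDiff (C : Set S) (B : Set S))
    rw [Walk.length_cons]
    omega

/-- A map into a hypercube under which the distance of `G` is the number of elements in which the
images differ makes `G` a partial cube. -/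
theorem Connected.isPartialCube_of_embedding (hG : G.Connected) {S : Type u} (φ : V → Finset S)
    (hφ : ∀ u v, G.dist u v = (symmDiff (φ u : Set S) (φ v : Set S)).ncard) :
    G.IsPartialCube := by
  have hadj : ∀ u v, G.Adj u v ↔ (hypercube S).Adj (φ u) (φ v) := by
    intro u v
    rw [← dist_eq_one_iff_adj, hφ]
    rfl
  have hinj : Function.Injective φ := by
    intro u v h
    have := hφ u v
    rw [h, symmDiff_self] at this
    exact hG.dist_eq_zero_iff.1 (by simpa using this)
  let H : (hypercube S).Subgraph := (⊤ : (hypercube S).Subgraph).induce (Set.range φ)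
  let e : G ≃g H.coe :=
    { toEquiv := Equiv.ofInjective φ hinj
      map_rel_iff' := by
        intro u v
        rw [hadj]
        exact ⟨fun h => h.2.2, fun h => ⟨⟨u, rfl⟩, ⟨v, rfl⟩, h⟩⟩ }
  have he : ∀ u, ((e u : H.verts) : Finset S) = φ u := fun u => rfl
  let f : G →g hypercube S := ⟨φ, fun h => (hadj _ _).1 h⟩
  refine ⟨S, H, ⟨⟨(e.connected_iff).1 hG⟩, ?_⟩, ⟨e⟩⟩
  intro x y
  obtain ⟨u, rfl⟩ := e.surjective x
  obtain ⟨v, rfl⟩ := e.surjective y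
  rw [dist_iso e hG, he, he]
  obtain ⟨p, hp⟩ := hG.exists_walk_length_eq_dist u v
  let q : (hypercube S).Walk (φ u) (φ v) := p.map f
  have hq : q.length = p.length := Walk.length_map f p
  apply le_antisymm
  · obtain ⟨r, hr⟩ := q.reachable.exists_walk_length_eq_dist
    rw [← hr, hφ]
    exact hypercube_ncard_symmDiff_le r
  · rw [← hp, ← hq]
    exact dist_le q

variable (hG : G.Connected) (hb : G.IsBipartite)
include hG hb

/-- A vertex on the `a`-side but closer to `w` than to `v` would have `w` on a geodesic to `v`,
contradicting convexity. The reverse inclusion uses convexity of the complement `closerSet b a` in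
the same way. -/
theorem closerSet_eq_of_mem_of_notMem
    (hconv : ∀ a b, G.Adj a b → G.IsGeodesicConvex (G.closerSet a b)) {a b v w : V}
    (hab : G.Adj a b) (hvw : G.Adj v w) (hv : v ∈ G.closerSet a b) (hw : w ∉ G.closerSet a b) :
    G.closerSet a b = G.closerSet v w := by
  have e := dist_eq_one_iff_adj.2 hvw
  have e' := dist_eq_one_iff_adj.2 hvw.symm
  ext x
  have hx := hG.dist_adj_cases hb hvw x
  constructor
  · intro h
    by_contra hcon
    rw [mem_closerSet] at hcon
    refine hw (hconv a b hab x h v hv ?_)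
    rw [hG.mem_geodesicInterval]
    omega
  · intro h
    by_contra hcon
    rw [hG.notMem_closerSet hb hab] at hcon hw
    rw [mem_closerSet] at h
    refine (hG.notMem_closerSet hb hab.symm).2 hv (hconv b a hab.symm x hcon w hw ?_)
    rw [hG.mem_geodesicInterval]
    omega

/-- Only the two halfspaces of `vw` distinguish `v` from `w`, and excluding `v₀` keeps exactly one
of them. -/
theorem symmDiff_separatingSets_of_adj
    (hconv : ∀ a b, G.Adj a b → G.IsGeodesicConvex (G.closerSet a b)) (v₀ : V) {v w : V}
    (hvw : G.Adj v w) : symmDiff (G.separatingSets v₀ v) (G.separatingSets v₀ w) =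
      {G.closerSet v w} ∨ symmDiff (G.separatingSets v₀ v) (G.separatingSets v₀ w) =
      {G.closerSet w v} := by
  have key : ∀ {v w}, G.Adj v w → v₀ ∈ G.closerSet w v →
      symmDiff (G.separatingSets v₀ v) (G.separatingSets v₀ w) = {G.closerSet v w} := by
    intro v w hvw h
    have e := dist_eq_one_iff_adj.2 hvw
    have e' := dist_eq_one_iff_adj.2 hvw.symm
    ext H
    rw [Set.mem_symmDiff, Set.mem_singleton_iff]
    constructor
    · rintro (⟨⟨⟨a, b, hab, rfl⟩, hv, h₀⟩, hn⟩ | ⟨⟨⟨a, b, hab, rfl⟩, hw, h₀⟩, hn⟩)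
      · exact closerSet_eq_of_mem_of_notMem hG hb hconv hab hvw hv
          (fun hw => hn ⟨⟨a, b, hab, rfl⟩, hw, h₀⟩)
      · exfalso
        rw [closerSet_eq_of_mem_of_notMem hG hb hconv hab hvw.symm hw
          (fun hv => hn ⟨⟨a, b, hab, rfl⟩, hv, h₀⟩)] at h₀
        exact h₀ h
    · rintro rfl
      refine Or.inl ⟨⟨⟨v, w, hvw, rfl⟩, ?_, ?_⟩, fun hn => ?_⟩
      · rw [mem_closerSet, dist_self]; omega
      · rw [mem_closerSet] at h ⊢; omega
      · have := hn.2.1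
        rw [mem_closerSet, dist_self] at this
        omega
  by_cases h : v₀ ∈ G.closerSet w v
  · exact Or.inl (key hvw h)
  · rw [hG.notMem_closerSet hb hvw.symm] at h
    rw [symmDiff_comm]
    exact Or.inr (key hvw.symm h)

theorem dist_eq_ncard_symmDiff_separatingSets
    (hconv : ∀ a b, G.Adj a b → G.IsGeodesicConvex (G.closerSet a b)) (v₀ : V) :
    ∀ (k : ℕ) (u v : V), G.dist u v = k →
      (symmDiff (G.separatingSets v₀ u) (G.separatingSets v₀ v)).Finite ∧
      (symmDiff (G.separatingSets v₀ u) (G.separatingSets v₀ v)).ncard = k := by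
  intro k
  induction k with
  | zero =>
    intro u v h
    rw [hG.dist_eq_zero_iff] at h
    subst h
    simp
  | succ k ih =>
    intro u v h
    obtain ⟨r, hur, hrv⟩ := hG.exists_adj_dist_add_one (p := u) (q := v)
      (by rintro rfl; rw [dist_self] at h; omega)
    obtain ⟨hfin, hcard⟩ := ih r v (by omega)
    have hsplit : symmDiff (G.separatingSets v₀ u) (G.separatingSets v₀ v) =
        symmDiff (symmDiff (G.separatingSets v₀ u) (G.separatingSets v₀ r))
          (symmDiff (G.separatingSets v₀ r) (G.separatingSets v₀ v)) := by
      rw [symmDiff_assoc, symmDiff_symmDiff_cancel_left]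
    have e := dist_eq_one_iff_adj.2 hur
    have hr : r ∈ G.closerSet r u := by rw [mem_closerSet, dist_self, G.dist_comm]; omega
    have hv : v ∈ G.closerSet r u := by
      rw [mem_closerSet, G.dist_comm (u := v), G.dist_comm (u := v)]; omega
    -- The halfspace crossed by the first edge of the geodesic is not crossed again, since `r` and
    -- `v` are on the same side of `ur`. Each edge thus contributes a new element.
    have hmem : ∀ H, H = G.closerSet u r ∨ H = G.closerSet r u →
        H ∉ symmDiff (G.separatingSets v₀ r) (G.separatingSets v₀ v) := by
      intro H hH hmem
      have hiff : r ∈ H ↔ v ∈ H := by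
        rcases hH with rfl | rfl
        · exact iff_of_false ((hG.notMem_closerSet hb hur).2 hr)
            ((hG.notMem_closerSet hb hur).2 hv)
        · exact iff_of_true hr hv
      rcases hmem with ⟨⟨h1, h2, h3⟩, h4⟩ | ⟨⟨h1, h2, h3⟩, h4⟩
      · exact h4 ⟨h1, hiff.1 h2, h3⟩
      · exact h4 ⟨h1, hiff.2 h2, h3⟩
    have fin : ∀ H, H ∉ symmDiff (G.separatingSets v₀ r) (G.separatingSets v₀ v) →
        (symmDiff {H} (symmDiff (G.separatingSets v₀ r) (G.separatingSets v₀ v))).Finite ∧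
        (symmDiff {H} (symmDiff (G.separatingSets v₀ r) (G.separatingSets v₀ v))).ncard =
          k + 1 := by
      intro H hH
      have : symmDiff {H} (symmDiff (G.separatingSets v₀ r) (G.separatingSets v₀ v)) =
          insert H (symmDiff (G.separatingSets v₀ r) (G.separatingSets v₀ v)) :=
        (Set.disjoint_singleton_left.2 hH).symmDiff_eq_sup
      rw [this, Set.ncard_insert_of_notMem hH hfin, hcard]
      exact ⟨hfin.insert _, rfl⟩
    rw [hsplit]
    rcases symmDiff_separatingSets_of_adj hG hb hconv v₀ hur with h | h
    · rw [h]; exact fin _ (hmem _ (Or.inl rfl))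
    · rw [h]; exact fin _ (hmem _ (Or.inr rfl))

/-- **Djoković's theorem**: a connected bipartite graph in which all sets `closerSet a b` are convex
is a partial cube. -/
theorem isPartialCube_of_isGeodesicConvex_closerSet
    (hconv : ∀ a b, G.Adj a b → G.IsGeodesicConvex (G.closerSet a b)) : G.IsPartialCube := by
  obtain ⟨v₀⟩ := hG.nonempty
  have h₀ : G.separatingSets v₀ v₀ = ∅ :=
    Set.eq_empty_of_forall_notMem fun H hH => hH.2.2 hH.2.1
  have hfin : ∀ v, (G.separatingSets v₀ v).Finite := by
    intro v
    have := (dist_eq_ncard_symmDiff_separatingSets hG hb hconv v₀ _ v v₀ rfl).1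
    rwa [h₀, ← Set.bot_eq_empty, symmDiff_bot] at this
  refine hG.isPartialCube_of_embedding (fun v => (hfin v).toFinset) fun u v => ?_
  rw [Set.Finite.coe_toFinset, Set.Finite.coe_toFinset]
  exact (dist_eq_ncard_symmDiff_separatingSets hG hb hconv v₀ _ u v rfl).2.symm

end SimpleGraph

theorem theoremT {V : Type u} (G : SimpleGraph V) (hconn : G.Connected) (hbip : G.IsBipartite)
    (hph : G.preHullNumber ≤ 1) : G.IsPartialCube := by
  exact SimpleGraph.isPartialCube_of_isGeodesicConvex_closerSet hconn hbip fun _ _ hab =>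
    SimpleGraph.isGeodesicConvex_closerSet hconn hbip hph hab
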